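/- **Setting.** Let $Z\subseteq\mathbb{R}^n$ be a convex set and let $f$ be a real-valued convex function on a convex set $\operatorname{Dom} f\subseteq\mathbb{R}^n$ with $Z\subseteq\operatorname{Dom} f$, Borel measurable on $Z$. Let $W\in\mathbb{R}^{m\times r}$ and $q\in\mathbb{R}^r$ be fixed. For a scenario $\xi=(h,T)\in\mathbb{R}^m\times\mathbb{R}^{m\times n}$ let $$G(z,\xi)=f(z)+Q(z,\xi),\qquad Q(z,\xi)=\min\{q^\top y:\ Wy=h-Tz,\ y\ge 0\}.$$ Let $X$ be a random vector in $\mathbb{R}^s$ with distribution $F_X$ and support $\mathcal{X}$, let $\xi$ be a random scenario on the same probability space, and let $\mathbb{E}[\,\cdot\mid X=x]$ be computed with any fixed regular conditional distribution of $\xi$ given $X$. Let $\Pi$ be the set of measurable maps $\pi:\mathcal{X}\to Z$, and for $\pi\in\Pi$ let $$\mathcal{P}(\pi)=\int_{\mathcal{X}}\mathbb{E}[G(\pi(x),\xi)\mid X=x]\,F_X(dx)\in[-\infty,+\infty],$$ where the expectation (or integral) of $Y$ is $\mathbb{E}[Y^+]-\mathbb{E}[Y^-]$, taken as $+\infty$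 if $\mathbb{E}[Y^+]=+\infty$. **Proposition 1.** Suppose that (Assumption 1) $Z\neq\emptyset$ and the relative interior of $\operatorname{Dom} f$ is non-empty, and (Assumption 2) the dual feasible set $U=\{u\in\mathbb{R}^m: W^\top u\le q\}$ is non-empty and bounded. Then: 1. If $\pi_S\in\Pi$ satisfies $\pi_S(x)\in\operatorname{argmin}_{z\in Z}\mathbb{E}[G(z,\xi)\mid X=x]$ for all $x\in\mathcal{X}$, then $\mathcal{P}(\pi_S)\le\mathcal{P}(\pi)$ for all $\pi\in\Pi$. 2. Conversely, let $\pi^*\in\Pi$ minimize $\mathcal{P}$ over $\Pi$, with $\mathcal{P}(\pi^*)$ finite, and suppose that a policy $\pi_S\in\Pi$ as in part 1 exists or that $\mathbb{E}[G(z,\xi)]$ is finite for every $z\in Z$. Then $\pi^*(x)\in\operatorname{argmin}_{z\in Z}\mathbb{E}[G(z,\xi)\mid X=x]$ for $F_X$-almost every $x$. 3. For every $\pi\in\Pi$ such that the positive part or the negative part of $G(\pi(X),\xi)$ has finite expectation, $\mathcal{P}(\pi)=\mathbb{E}[G(\pi(X),\xi)]$. -/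

import Mathlib

open MeasureTheory ProbabilityTheory Matrix

noncomputable section

namespace ContextualTwoStage

/-- Scenarios `ξ = (h, T)` with `h ∈ ℝ^m` and `T` a real `m × n` matrix. -/
abbrev Scenario (m n : ℕ) := (Fin m → ℝ) × (Fin m → Fin n → ℝ)

/-- The feasible set `{y : W y = h - T z, y ≥ 0}` of the second stage. -/
def recourseSet {n m r : ℕ} (W : Matrix (Fin m) (Fin r) ℝ)
    (z : Fin n → ℝ) (ξ : Scenario m n) : Set (Fin r → ℝ) :=
  {y | W *ᵥ y = ξ.1 - (Matrix.of ξ.2) *ᵥ z ∧ 0 ≤ y}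

/-- The second-stage optimal value `Q(z, ξ) = min {qᵀ y : W y = h - T z, y ≥ 0}`, as an extended
real (`+∞` if infeasible, `-∞` if unbounded). -/
def secondStage {n m r : ℕ} (W : Matrix (Fin m) (Fin r) ℝ) (q : Fin r → ℝ)
    (z : Fin n → ℝ) (ξ : Scenario m n) : EReal :=
  ⨅ y ∈ recourseSet W z ξ, ((q ⬝ᵥ y : ℝ) : EReal)

/-- The total cost `G(z, ξ) = f(z) + Q(z, ξ)`. -/
def totalCost {n m r : ℕ} (f : (Fin n → ℝ) → ℝ) (W : Matrix (Fin m) (Fin r) ℝ) (q : Fin r → ℝ)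
    (z : Fin n → ℝ) (ξ : Scenario m n) : EReal :=
  (f z : EReal) + secondStage W q z ξ

/-- The feasible set `U = {u : Wᵀ u ≤ q}` of the dual of the second stage. -/
def dualSet {m r : ℕ} (W : Matrix (Fin m) (Fin r) ℝ) (q : Fin r → ℝ) : Set (Fin m → ℝ) :=
  {u | Wᵀ *ᵥ u ≤ q}

/-- Expectation `E[Y⁺] - E[Y⁻]` of an extended-real-valued cost, with the convention of
minimization that it is `+∞` whenever `E[Y⁺] = +∞`. -/
def expect {α : Type*} [MeasurableSpace α] (μ : Measure α) (Y : α → EReal) : EReal :=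
  open Classical in
  if ∫⁻ a, (Y a).toENNReal ∂μ = ⊤ then ⊤
  else ((∫⁻ a, (Y a).toENNReal ∂μ : ENNReal) : EReal) -
    ((∫⁻ a, (-(Y a)).toENNReal ∂μ : ENNReal) : EReal)

/-- `κ` is a regular conditional distribution of `ξ` given `X`: `κ x` is the law of `ξ` given
`X = x`, i.e. the law of `X` and `κ` compose to the joint law of `(X, ξ)`. -/
def IsCondLaw {Ω A B : Type*} [MeasurableSpace Ω] [MeasurableSpace A] [MeasurableSpace B]
    (P : Measure Ω) (X : Ω → A) (ξ : Ω → B) (κ : Kernel A B) : Prop :=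
  IsMarkovKernel κ ∧ (P.map X) ⊗ₘ κ = P.map (fun ω => (X ω, ξ ω))

section Policies

variable {s n m : ℕ}

/-- The conditional cost `E[G(z, ξ) | X = x]`. -/
def condCost (κ : Kernel (Fin s → ℝ) (Scenario m n)) (G : (Fin n → ℝ) → Scenario m n → EReal)
    (z : Fin n → ℝ) (x : Fin s → ℝ) : EReal :=
  expect (κ x) (G z)

/-- `argmin_{z ∈ Z} E[G(z, ξ) | X = x]`. -/
def condArgmin (κ : Kernel (Fin s → ℝ) (Scenario m n)) (G : (Fin n → ℝ) → Scenario m n → EReal)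
    (Z : Set (Fin n → ℝ)) (x : Fin s → ℝ) : Set (Fin n → ℝ) :=
  {z | z ∈ Z ∧ ∀ z' ∈ Z, condCost κ G z x ≤ condCost κ G z' x}

/-- Policies: measurable maps whose values on the support of the features lie in `Z`.
(What such a map does off the support has no influence on anything below.) -/
def policies (FX : Measure (Fin s → ℝ)) (Z : Set (Fin n → ℝ)) :
    Set ((Fin s → ℝ) → (Fin n → ℝ)) :=
  {π | Measurable π ∧ ∀ x ∈ FX.support, π x ∈ Z}

/-- Average performance `𝒫(π) = ∫ E[G(π(x), ξ) | X = x] F_X(dx)`. -/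
def performance (FX : Measure (Fin s → ℝ)) (κ : Kernel (Fin s → ℝ) (Scenario m n))
    (G : (Fin n → ℝ) → Scenario m n → EReal) (π : (Fin s → ℝ) → (Fin n → ℝ)) : EReal :=
  expect FX (fun x => condCost κ G (π x) x)

/-- `π` solves `min_{π ∈ Π} 𝒫(π)`. -/
def IsOptimalPolicy (FX : Measure (Fin s → ℝ)) (κ : Kernel (Fin s → ℝ) (Scenario m n))
    (G : (Fin n → ℝ) → Scenario m n → EReal) (Z : Set (Fin n → ℝ))
    (π : (Fin s → ℝ) → (Fin n → ℝ)) : Prop :=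
  π ∈ policies FX Z ∧ ∀ π' ∈ policies FX Z, performance FX κ G π ≤ performance FX κ G π'

/-- `π` is a policy that selects an optimal solution of the conditional problem for every `x` in
the support of the features. -/
def IsCondOptimalPolicy (FX : Measure (Fin s → ℝ)) (κ : Kernel (Fin s → ℝ) (Scenario m n))
    (G : (Fin n → ℝ) → Scenario m n → EReal) (Z : Set (Fin n → ℝ))
    (π : (Fin s → ℝ) → (Fin n → ℝ)) : Prop :=
  π ∈ policies FX Z ∧ ∀ x ∈ FX.support, π x ∈ condArgmin κ G Z x

end Policies

end ContextualTwoStage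

end

open ContextualTwoStage

/-! ### Countable sets that control convex functions -/

section Convex

open Set

/-! The direct implication is monotonicity of the extended expectation, and the formula for the
performance is disintegration of the joint law (`expect_compProd`).

The converse rests on patching (`IsOptimalPolicy.condCost_le_ae`): switching an optimal policy to a
competitor exactly where the competitor is conditionally cheaper cannot lower a finite minimum, so
that region is null. A pointwise optimal policy, if one exists, is a sufficient competitor.
Otherwise the competitors are constant policies; each brings its own null set, so only countably
many points of `Z` can be treated at once, and convexity must carry the bound to the rest of `Z`.
For a fixed `x`, integrability is known only on the countable set, so the conditional cost is finite
on an unknown convex set between it and `Z`. `IsConvexSkeleton` is uniform over such sets for this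
reason, and `le_expect_of_isConvexSkeleton` performs the extension.

Bounded non-empty `U` gives complete recourse, so the second-stage value is real, convex and
continuous in `h - T z`. -/

theorem Convex.interior_nonempty_of_closure {E : Type*} [NormedAddCommGroup E] [NormedSpace ℝ E]
    [FiniteDimensional ℝ E] {K : Set E} (hK : Convex ℝ K)
    (h : (interior (closure K)).Nonempty) : (interior K).Nonempty := by
  rw [hK.interior_nonempty_iff_affineSpan_eq_top]
  rw [hK.closure.interior_nonempty_iff_affineSpan_eq_top] at h
  rw [eq_top_iff, ← h]
  refine affineSpan_le.2 (closure_minimal (subset_affineSpan ℝ K) ?_)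
  exact AffineSubspace.closed_of_finiteDimensional _

/-- A convex set with empty interior spans a proper affine subspace, closed in finite dimension, so
its closure has empty interior too. -/
theorem Convex.interior_closure_eq_interior {E : Type*} [NormedAddCommGroup E] [NormedSpace ℝ E]
    [FiniteDimensional ℝ E] {K : Set E} (hK : Convex ℝ K) :
    interior (closure K) = interior K := by
  rcases (interior (closure K)).eq_empty_or_nonempty with h | h
  · rw [h]
    exact (subset_empty_iff.1 (h ▸ interior_mono subset_closure)).symm
  · exact hK.interior_closure_eq_interior_of_nonempty_interior (hK.interior_nonempty_of_closure h)

/-- A lower bound for a convex function on a dense subset is a lower bound everywhere. -/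
theorem ConvexOn.le_of_forall_dense_le {E : Type*} [NormedAddCommGroup E] [NormedSpace ℝ E]
    [FiniteDimensional ℝ E] {C S : Set E} {h : E → ℝ} {c : ℝ} (hh : ConvexOn ℝ C h)
    (hC : (interior C).Nonempty) (hS : C ⊆ closure S) (hc : ∀ z ∈ S, c ≤ h z) :
    ∀ z ∈ C, c ≤ h z := by
  have hint : ∀ z ∈ interior C, c ≤ h z := by
    intro z hz
    by_contra! hlt
    have hcont : ContinuousAt h z :=
      hh.continuousOn_interior.continuousAt (isOpen_interior.mem_nhds hz)
    have hev := hcont.eventually (gt_mem_nhds hlt)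
    obtain ⟨w, hw, hwS⟩ := mem_closure_iff_nhds.1 (hS (interior_subset hz)) _ hev
    exact absurd (hc w hwS) (not_le.2 hw)
  obtain ⟨z₀, hz₀⟩ := hC
  intro z hz
  -- At a boundary point `h` may be discontinuous. The segment to an interior point `z₀` has
  -- interior points, where the bound is known; convexity and `t → 0` transfer it to `z`.
  have hseg : ∀ t ∈ Ioo (0 : ℝ) 1, c ≤ t * h z₀ + (1 - t) * h z := by
    intro t ht
    have hm : t • z₀ + (1 - t) • z ∈ interior C :=
      hh.1.openSegment_interior_self_subset_interior hz₀ hz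
        ⟨t, 1 - t, ht.1, by linarith [ht.2], by ring, rfl⟩
    exact (hint _ hm).trans
      (hh.2 (interior_subset hz₀) hz ht.1.le (by linarith [ht.2]) (by ring))
  have hlim : Filter.Tendsto (fun t : ℝ => t * h z₀ + (1 - t) * h z) (nhdsWithin 0 (Ioi 0))
      (nhds (0 * h z₀ + (1 - 0) * h z)) :=
    (Continuous.tendsto (by fun_prop) 0).mono_left nhdsWithin_le_nhds
  simp only [zero_mul, sub_zero, one_mul, zero_add] at hlim
  exact ge_of_tendsto hlim (Filter.mem_of_superset (Ioo_mem_nhdsGT one_pos) hseg)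

/-- `S` is a countable subset of `Z` such that, for every convex set `C` between `S` and `Z`, lower
bounds on `S` of convex functions on `C` are lower bounds on `C`, and every point of `Z` is
separated from some point of `C` by a point of `S`. -/
def IsConvexSkeleton {E : Type*} [AddCommGroup E] [Module ℝ E] (S Z : Set E) : Prop :=
  S ⊆ Z ∧ S.Countable ∧ ∀ C : Set E, Convex ℝ C → S ⊆ C → C ⊆ Z →
    (∀ (h : E → ℝ) (c : ℝ), ConvexOn ℝ C h → (∀ z ∈ S, c ≤ h z) → ∀ z ∈ C, c ≤ h z) ∧
    ∀ z ∈ Z, ∃ w ∈ C, ∃ t ∈ Ioo (0 : ℝ) 1, (1 - t) • w + t • z ∈ S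

/-- Any countable dense subset of `Z` works: a convex `C` containing it has closure containing `Z`,
hence contains the interior of `Z`. For the separation, the segment from `z` to a point `s` of `S`
in the interior is prolonged slightly beyond `s`. -/
theorem exists_isConvexSkeleton_of_interior {E : Type*} [NormedAddCommGroup E]
    [NormedSpace ℝ E] [FiniteDimensional ℝ E] {Z : Set E}
    (hint : (interior Z).Nonempty) : ∃ S, IsConvexSkeleton S Z := by
  obtain ⟨S, hSZ, hSc, hS⟩ :=
    (TopologicalSpace.IsSeparable.of_separableSpace Z).exists_countable_dense_subset
  refine ⟨S, hSZ, hSc, fun C hC hSC hCZ => ?_⟩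
  have hZC : interior Z ⊆ interior C := by
    rw [← hC.interior_closure_eq_interior]
    exact interior_mono (hS.trans (closure_mono hSC))
  refine ⟨fun h c hh hc => hh.le_of_forall_dense_le (hint.mono hZC) (hCZ.trans hS) hc,
    fun z hz => ?_⟩
  obtain ⟨z₀, hz₀⟩ := hint
  obtain ⟨s, hs, hsS⟩ := mem_closure_iff.1 (hS (interior_subset hz₀)) _ isOpen_interior hz₀
  have hlim : Filter.Tendsto (fun ε : ℝ => s + ε • (s - z)) (nhdsWithin 0 (Ioi 0))
      (nhds (s + (0 : ℝ) • (s - z))) :=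
    (Continuous.tendsto (by fun_prop) 0).mono_left nhdsWithin_le_nhds
  rw [zero_smul, add_zero] at hlim
  obtain ⟨ε, hε, hε0⟩ := ((hlim.eventually (isOpen_interior.mem_nhds hs)).and
    self_mem_nhdsWithin).exists
  have hε0 : 0 < ε := hε0
  have hne : 1 + ε ≠ 0 := by positivity
  -- The weight solves `(1 - t) (1 + ε) = 1`, which places the combination at `s`.
  refine ⟨s + ε • (s - z), interior_subset (hZC hε), ε / (1 + ε),
    ⟨by positivity, by rw [div_lt_one (by positivity)]; linarith⟩, ?_⟩
  convert hsS using 1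
  have h1 : 1 - ε / (1 + ε) = (1 + ε)⁻¹ := by field_simp; ring
  rw [h1, div_eq_inv_mul, mul_smul, ← smul_add, inv_smul_eq_iff₀ hne]
  module

/-- Inside its affine span `Z` has interior points, and the skeleton property transports along an
affine parametrization of the span. -/
theorem Convex.exists_isConvexSkeleton {E : Type*} [NormedAddCommGroup E]
    [NormedSpace ℝ E] [FiniteDimensional ℝ E] {Z : Set E} (hZ : Convex ℝ Z)
    (hne : Z.Nonempty) : ∃ S, IsConvexSkeleton S Z := by
  obtain ⟨p, hp⟩ := hne
  let A := affineSpan ℝ Z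
  let p' : A := ⟨p, subset_affineSpan ℝ Z hp⟩
  have : Nonempty A := ⟨p'⟩
  let e : A.direction ≃ᵃⁱ[ℝ] A := AffineIsometryEquiv.vaddConst ℝ p'
  let φ : A.direction →ᵃ[ℝ] E := A.subtype.comp e.toAffineEquiv.toAffineMap
  have hφ : ∀ z ∈ Z, ∃ v, φ v = z := fun z hz =>
    ⟨e.symm ⟨z, subset_affineSpan ℝ Z hz⟩, by simp [φ]⟩
  have hint : (interior (φ ⁻¹' Z)).Nonempty := by
    obtain ⟨x, y, hy, -⟩ := Set.Nonempty.intrinsicInterior hZ ⟨p, hp⟩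
    have : φ ⁻¹' Z = e.toHomeomorph ⁻¹' ((↑) ⁻¹' Z : Set A) := rfl
    rw [this, ← Homeomorph.preimage_interior]
    exact ⟨e.symm y, by simpa using hy⟩
  obtain ⟨S, hSZ, hSc, hS⟩ := exists_isConvexSkeleton_of_interior hint
  refine ⟨φ '' S, image_subset_iff.2 hSZ, hSc.image _, fun C hC hSC hCZ => ?_⟩
  obtain ⟨h1, h2⟩ := hS (φ ⁻¹' C) (hC.affine_preimage φ) (image_subset_iff.1 hSC)
    (preimage_mono hCZ)
  constructor
  · intro h c hh hc z hz
    obtain ⟨v, rfl⟩ := hφ z (hCZ hz)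
    exact h1 (h ∘ φ) c (hh.comp_affineMap φ) (fun w hw => hc _ (mem_image_of_mem φ hw)) v hz
  · intro z hz
    obtain ⟨v, rfl⟩ := hφ z hz
    obtain ⟨w, hw, t, ht, hm⟩ := h2 v hz
    refine ⟨φ w, hw, t, ht, ?_⟩
    rw [← Convex.combo_affine_apply (by ring)]
    exact mem_image_of_mem φ hm

end Convex

/-! ### Complete recourse and regularity of the second-stage value -/

section Recourse

open Set

variable {n m r : ℕ}

theorem dualSet_weak_duality {W : Matrix (Fin m) (Fin r) ℝ} {q : Fin r → ℝ}
    {u : Fin m → ℝ} (hu : u ∈ dualSet W q) {y : Fin r → ℝ} (hy : 0 ≤ y) :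
    u ⬝ᵥ (W *ᵥ y) ≤ q ⬝ᵥ y := by
  rw [dotProduct_mulVec, ← mulVec_transpose]
  exact dotProduct_le_dotProduct_of_nonneg_right hu hy

/-- Complete recourse: a non-empty bounded dual feasible set makes every right-hand side
feasible. -/
theorem exists_nonneg_mulVec_eq {W : Matrix (Fin m) (Fin r) ℝ} {q : Fin r → ℝ}
    (hUne : (dualSet W q).Nonempty) (hUb : Bornology.IsBounded (dualSet W q)) (v : Fin m → ℝ) :
    ∃ y : Fin r → ℝ, W *ᵥ y = v ∧ 0 ≤ y := by
  let K : Set (Fin m → ℝ) := W.mulVecLin '' Ici 0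
  have hK : Convex ℝ K := (convex_Ici 0).linear_image _
  -- A dense convex set in finite dimension is everything. If the cone is not dense, a separating
  -- functional `d` satisfies `Wᵀ d ≤ 0`, so `U` contains a ray in direction `d`.
  suffices hcl : closure K = univ by
    have hv : v ∈ interior K := by
      rw [← hK.interior_closure_eq_interior, hcl, interior_univ]
      trivial
    obtain ⟨y, hy, rfl⟩ := interior_subset hv
    exact ⟨y, rfl, hy⟩
  by_contra hcl
  obtain ⟨w, hw⟩ := (ne_univ_iff_exists_notMem _).1 hcl
  obtain ⟨φ, c, hφ, hc⟩ := geometric_hahn_banach_closed_point hK.closure isClosed_closure hw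
  have hφK : ∀ y : Fin r → ℝ, 0 ≤ y → φ (W *ᵥ y) < c := fun y hy =>
    hφ _ (subset_closure ⟨y, hy, rfl⟩)
  have hc0 : 0 < c := by simpa using hφK 0 le_rfl
  have hnonpos : ∀ y : Fin r → ℝ, 0 ≤ y → φ (W *ᵥ y) ≤ 0 := by
    intro y hy
    by_contra! hpos
    -- The scaling makes the functional equal to `c`, against the strict bound.
    have h := hφK ((c / φ (W *ᵥ y)) • y) (smul_nonneg (by positivity) hy)
    rw [mulVec_smul, map_smul, smul_eq_mul, div_mul_cancel₀ _ hpos.ne'] at h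
    exact lt_irrefl _ h
  let d : Fin m → ℝ := fun i => φ (Pi.single i 1)
  have hd : ∀ x, φ x = d ⬝ᵥ x := by
    intro x
    conv_lhs => rw [pi_eq_sum_univ' x]
    simp [d, dotProduct, mul_comm]
  have hWd : Wᵀ *ᵥ d ≤ 0 := by
    intro j
    have h := hnonpos (Pi.single j 1) (by simp)
    rw [hd, dotProduct_mulVec, ← mulVec_transpose] at h
    simpa using h
  have hdw : 0 < d ⬝ᵥ w := hd w ▸ hc0.trans hc
  obtain ⟨u, hu⟩ := hUne
  have hray : ∀ t : ℝ, 0 ≤ t → u + t • d ∈ dualSet W q := by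
    intro t ht
    change Wᵀ *ᵥ (u + t • d) ≤ q
    rw [mulVec_add, mulVec_smul]
    calc Wᵀ *ᵥ u + t • (Wᵀ *ᵥ d) ≤ q + 0 :=
          add_le_add hu (smul_nonpos_of_nonneg_of_nonpos ht hWd)
      _ = q := add_zero q
  have hd0 : d ≠ 0 := by
    rintro h
    simp [h] at hdw
  obtain ⟨R, hR⟩ := hUb.exists_norm_le
  have hpos : 0 < ‖d‖ := norm_pos_iff.2 hd0
  have hR0 : 0 ≤ R := (norm_nonneg u).trans (hR u hu)
  -- Two points of norm at most `R` are at distance at most `2 * R`; this step along the ray has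
  -- length `2 * R + 1`.
  have ht : 0 ≤ (2 * R + 1) / ‖d‖ := by positivity
  have h1 := hR _ (hray _ ht)
  have h2 : ‖((2 * R + 1) / ‖d‖) • d‖ = 2 * R + 1 := by
    rw [norm_smul, Real.norm_of_nonneg ht, div_mul_cancel₀ _ hpos.ne']
  have h3 := norm_sub_le (u + ((2 * R + 1) / ‖d‖) • d) u
  rw [add_sub_cancel_left, h2] at h3
  linarith [hR u hu]

/-- The second-stage value as a real function of the right-hand side `v = h - T z`. -/
noncomputable def recourseValue (W : Matrix (Fin m) (Fin r) ℝ) (q : Fin r → ℝ)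
    (v : Fin m → ℝ) : ℝ :=
  sInf ((fun y => q ⬝ᵥ y) '' {y | W *ᵥ y = v ∧ 0 ≤ y})

theorem recourseValue_bddBelow {W : Matrix (Fin m) (Fin r) ℝ} {q : Fin r → ℝ}
    (hUne : (dualSet W q).Nonempty) (v : Fin m → ℝ) :
    BddBelow ((fun y => q ⬝ᵥ y) '' {y | W *ᵥ y = v ∧ 0 ≤ y}) := by
  obtain ⟨u, hu⟩ := hUne
  refine ⟨u ⬝ᵥ v, ?_⟩
  rintro _ ⟨y, ⟨rfl, hy⟩, rfl⟩
  exact dualSet_weak_duality hu hy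

theorem recourseValue_nonempty {W : Matrix (Fin m) (Fin r) ℝ} {q : Fin r → ℝ}
    (hUne : (dualSet W q).Nonempty) (hUb : Bornology.IsBounded (dualSet W q)) (v : Fin m → ℝ) :
    ((fun y => q ⬝ᵥ y) '' {y | W *ᵥ y = v ∧ 0 ≤ y}).Nonempty :=
  Set.Nonempty.image _ (exists_nonneg_mulVec_eq hUne hUb v)

theorem secondStage_eq_coe {W : Matrix (Fin m) (Fin r) ℝ} {q : Fin r → ℝ}
    (hUne : (dualSet W q).Nonempty) (hUb : Bornology.IsBounded (dualSet W q))
    (z : Fin n → ℝ) (ξ : Scenario m n) :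
    secondStage W q z ξ = (recourseValue W q (ξ.1 - Matrix.of ξ.2 *ᵥ z) : EReal) := by
  apply le_antisymm
  · rw [← EReal.le_of_forall_lt_iff_le]
    intro M hM
    rw [EReal.coe_lt_coe_iff, recourseValue,
      csInf_lt_iff (recourseValue_bddBelow hUne _) (recourseValue_nonempty hUne hUb _)] at hM
    obtain ⟨_, ⟨y, hy, rfl⟩, hyM⟩ := hM
    exact (iInf₂_le y hy).trans (EReal.coe_le_coe_iff.2 hyM.le)
  · refine le_iInf₂ fun y hy => EReal.coe_le_coe_iff.2 ?_
    exact csInf_le (recourseValue_bddBelow hUne _) ⟨y, hy, rfl⟩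

/-- Convex combinations of `ε`-optimal recourse decisions are feasible for the combined right-hand
side. Finiteness on the whole space then yields continuity, hence measurability of the cost. -/
theorem convexOn_recourseValue {W : Matrix (Fin m) (Fin r) ℝ} {q : Fin r → ℝ}
    (hUne : (dualSet W q).Nonempty) (hUb : Bornology.IsBounded (dualSet W q)) :
    ConvexOn ℝ univ (recourseValue W q) := by
  refine ⟨convex_univ, fun v₁ _ v₂ _ a b ha hb hab => ?_⟩
  refine le_of_forall_pos_le_add fun ε hε => ?_
  obtain ⟨_, ⟨y₁, ⟨hy₁, hy₁0⟩, rfl⟩, h₁⟩ :=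
    Real.lt_sInf_add_pos (recourseValue_nonempty hUne hUb v₁) hε
  obtain ⟨_, ⟨y₂, ⟨hy₂, hy₂0⟩, rfl⟩, h₂⟩ :=
    Real.lt_sInf_add_pos (recourseValue_nonempty hUne hUb v₂) hε
  have h : recourseValue W q (a • v₁ + b • v₂) ≤ q ⬝ᵥ (a • y₁ + b • y₂) := by
    refine csInf_le (recourseValue_bddBelow hUne _) ⟨a • y₁ + b • y₂, ⟨?_, ?_⟩, rfl⟩
    · rw [mulVec_add, mulVec_smul, mulVec_smul, hy₁, hy₂]
    · exact add_nonneg (smul_nonneg ha hy₁0) (smul_nonneg hb hy₂0)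
  rw [dotProduct_add, dotProduct_smul, dotProduct_smul] at h
  change _ < recourseValue W q v₁ + ε at h₁
  change _ < recourseValue W q v₂ + ε at h₂
  simp only [smul_eq_mul] at h ⊢
  have e₁ := mul_le_mul_of_nonneg_left h₁.le ha
  have e₂ := mul_le_mul_of_nonneg_left h₂.le hb
  have e₃ : a * ε + b * ε = ε := by rw [← add_mul, hab, one_mul]
  linarith

theorem continuous_recourseValue {W : Matrix (Fin m) (Fin r) ℝ} {q : Fin r → ℝ}
    (hUne : (dualSet W q).Nonempty) (hUb : Bornology.IsBounded (dualSet W q)) :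
    Continuous (recourseValue W q) :=
  (convexOn_recourseValue hUne hUb).locallyLipschitz.continuous

/-- The total cost as a real number. -/
noncomputable def realCost (f : (Fin n → ℝ) → ℝ) (W : Matrix (Fin m) (Fin r) ℝ) (q : Fin r → ℝ)
    (z : Fin n → ℝ) (ξ : Scenario m n) : ℝ :=
  f z + recourseValue W q (ξ.1 - Matrix.of ξ.2 *ᵥ z)

theorem totalCost_eq_coe {W : Matrix (Fin m) (Fin r) ℝ} {q : Fin r → ℝ}
    (hUne : (dualSet W q).Nonempty) (hUb : Bornology.IsBounded (dualSet W q))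
    (f : (Fin n → ℝ) → ℝ) (z : Fin n → ℝ) (ξ : Scenario m n) :
    totalCost f W q z ξ = (realCost f W q z ξ : EReal) := by
  rw [totalCost, secondStage_eq_coe hUne hUb, ← EReal.coe_add, realCost]

theorem convexOn_realCost {W : Matrix (Fin m) (Fin r) ℝ} {q : Fin r → ℝ}
    (hUne : (dualSet W q).Nonempty) (hUb : Bornology.IsBounded (dualSet W q))
    {f : (Fin n → ℝ) → ℝ} {Z : Set (Fin n → ℝ)} (hf : ConvexOn ℝ Z f) (ξ : Scenario m n) :
    ConvexOn ℝ Z (fun z => realCost f W q z ξ) := by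
  refine hf.add ⟨hf.1, fun z₁ _ z₂ _ a b ha hb hab => ?_⟩
  have h := (convexOn_recourseValue hUne hUb).2 (mem_univ (ξ.1 - Matrix.of ξ.2 *ᵥ z₁))
    (mem_univ (ξ.1 - Matrix.of ξ.2 *ᵥ z₂)) ha hb hab
  convert h using 2
  rw [mulVec_add, mulVec_smul, mulVec_smul, smul_sub, smul_sub]
  nth_rewrite 1 [← one_smul ℝ ξ.1]
  rw [← hab, add_smul]
  abel

theorem measurable_realCost {W : Matrix (Fin m) (Fin r) ℝ} {q : Fin r → ℝ}
    (hUne : (dualSet W q).Nonempty) (hUb : Bornology.IsBounded (dualSet W q))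
    (f : (Fin n → ℝ) → ℝ) (z : Fin n → ℝ) :
    Measurable (realCost f W q z : Scenario m n → ℝ) := by
  refine measurable_const.add ((continuous_recourseValue hUne hUb).measurable.comp ?_)
  refine measurable_pi_lambda _ fun i => ?_
  simp only [Pi.sub_apply, mulVec, dotProduct, Matrix.of_apply]
  fun_prop

theorem measurable_realCost_comp {A : Type*} [MeasurableSpace A]
    {W : Matrix (Fin m) (Fin r) ℝ} {q : Fin r → ℝ}
    (hUne : (dualSet W q).Nonempty) (hUb : Bornology.IsBounded (dualSet W q))
    {f : (Fin n → ℝ) → ℝ} {Z : Set (Fin n → ℝ)} (hfm : Measurable (fun z : Z => f z))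
    {π : A → (Fin n → ℝ)} (hπ : Measurable π) (hπZ : ∀ a, π a ∈ Z) :
    Measurable (fun p : A × Scenario m n => realCost f W q (π p.1) p.2) := by
  have h1 : Measurable (fun p : A × Scenario m n => f (π p.1)) :=
    (hfm.comp (hπ.subtype_mk (h := hπZ))).comp measurable_fst
  refine h1.add ((continuous_recourseValue hUne hUb).measurable.comp ?_)
  refine measurable_pi_lambda _ fun i => ?_
  simp only [Pi.sub_apply, mulVec, dotProduct, Matrix.of_apply]
  fun_prop

end Recourse

/-! ### Extended expectations and their disintegration -/

section Expectation

open Set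

/-- The difference `a - b`, with the convention that it is `+∞` whenever `a = +∞`. -/
noncomputable def topSub (a b : ENNReal) : EReal :=
  open Classical in if a = ⊤ then ⊤ else (a : EReal) - (b : EReal)

theorem expect_eq_topSub {α : Type*} [MeasurableSpace α] (μ : Measure α) (Y : α → EReal) :
    expect μ Y = topSub (∫⁻ a, (Y a).toENNReal ∂μ) (∫⁻ a, (-(Y a)).toENNReal ∂μ) := rfl

theorem topSub_top (b : ENNReal) : topSub ⊤ b = ⊤ := by simp [topSub]

theorem topSub_of_ne_top_of_top {a : ENNReal} (ha : a ≠ ⊤) : topSub a ⊤ = ⊥ := by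
  lift a to NNReal using ha
  simp [topSub]

theorem topSub_of_ne_top {a b : ENNReal} (ha : a ≠ ⊤) (hb : b ≠ ⊤) :
    topSub a b = ((a.toReal - b.toReal : ℝ) : EReal) := by
  lift a to NNReal using ha
  lift b to NNReal using hb
  simp [topSub]
  rfl

theorem topSub_mono {a a' b b' : ENNReal} (ha : a ≤ a') (hb : b' ≤ b) :
    topSub a b ≤ topSub a' b' := by
  rcases eq_or_ne a' ⊤ with rfl | ha'
  · simp [topSub_top]
  have ha₀ := ne_top_of_le_ne_top ha' ha
  rcases eq_or_ne b ⊤ with rfl | hb₀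
  · simp [topSub_of_ne_top_of_top ha₀]
  have hb' := ne_top_of_le_ne_top hb₀ hb
  rw [topSub_of_ne_top ha₀ hb₀, topSub_of_ne_top ha' hb', EReal.coe_le_coe_iff]
  exact sub_le_sub ((ENNReal.toReal_le_toReal ha₀ ha').2 ha)
    ((ENNReal.toReal_le_toReal hb' hb₀).2 hb)

theorem topSub_ne_top_iff {a b : ENNReal} : topSub a b ≠ ⊤ ↔ a ≠ ⊤ := by
  refine ⟨fun h ha => h (ha ▸ topSub_top b), fun ha => ?_⟩
  rcases eq_or_ne b ⊤ with rfl | hb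
  · simp [topSub_of_ne_top_of_top ha]
  · simp only [topSub_of_ne_top ha hb]
    exact EReal.coe_ne_top _

theorem ne_top_of_topSub_ne {a b : ENNReal} (h1 : topSub a b ≠ ⊤) (h2 : topSub a b ≠ ⊥) :
    a ≠ ⊤ ∧ b ≠ ⊤ := by
  have ha := topSub_ne_top_iff.1 h1
  refine ⟨ha, ?_⟩
  rintro rfl
  exact h2 (topSub_of_ne_top_of_top ha)

theorem topSub_inj_of_add_eq {a b a' b' : ENNReal} (ha : a ≠ ⊤) (hb : b ≠ ⊤) (ha' : a' ≠ ⊤)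
    (hb' : b' ≠ ⊤) (h : a + b' = b + a') : topSub a b = topSub a' b' := by
  rw [topSub_of_ne_top ha hb, topSub_of_ne_top ha' hb', EReal.coe_eq_coe_iff]
  have := congrArg ENNReal.toReal h
  rw [ENNReal.toReal_add ha hb', ENNReal.toReal_add hb ha'] at this
  linarith

theorem toENNReal_topSub_le (a b : ENNReal) : (topSub a b).toENNReal ≤ a := by
  calc (topSub a b).toENNReal ≤ (topSub a 0).toENNReal :=
        EReal.toENNReal_le_toENNReal (topSub_mono le_rfl zero_le)
    _ = a := by
        rcases eq_or_ne a ⊤ with rfl | ha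
        · simp [topSub_top]
        · simp [topSub_of_ne_top ha, ha]

theorem le_toENNReal_topSub_add (a b : ENNReal) : a ≤ (topSub a b).toENNReal + b := by
  rcases eq_or_ne a ⊤ with rfl | ha
  · simp [topSub_top]
  rcases eq_or_ne b ⊤ with rfl | hb
  · simp
  rw [topSub_of_ne_top ha hb, EReal.real_coe_toENNReal, ENNReal.ofReal_sub _ ENNReal.toReal_nonneg,
    ENNReal.ofReal_toReal ha, ENNReal.ofReal_toReal hb]
  exact le_tsub_add

theorem toENNReal_neg_topSub_le (a b : ENNReal) : (-topSub a b).toENNReal ≤ b := by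
  rcases eq_or_ne a ⊤ with rfl | ha
  · simp [topSub_top]
  rcases eq_or_ne b ⊤ with rfl | hb
  · simp
  rw [topSub_of_ne_top ha hb, ← EReal.coe_neg, neg_sub, EReal.real_coe_toENNReal,
    ENNReal.ofReal_sub _ ENNReal.toReal_nonneg, ENNReal.ofReal_toReal ha, ENNReal.ofReal_toReal hb]
  exact tsub_le_self

/-- This is `c⁺ + b = c⁻ + a` for `c = a - b`, written without subtraction so that it can be
integrated in `ENNReal`. -/
theorem toENNReal_topSub_add {a : ENNReal} (ha : a ≠ ⊤) (b : ENNReal) :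
    (topSub a b).toENNReal + b = (-topSub a b).toENNReal + a := by
  rcases eq_or_ne b ⊤ with rfl | hb
  · simp [topSub_of_ne_top_of_top ha]
  rw [topSub_of_ne_top ha hb, ← EReal.coe_neg, neg_sub, EReal.real_coe_toENNReal,
    EReal.real_coe_toENNReal, ENNReal.ofReal_sub _ ENNReal.toReal_nonneg,
    ENNReal.ofReal_sub _ ENNReal.toReal_nonneg, ENNReal.ofReal_toReal ha, ENNReal.ofReal_toReal hb]
  rw [tsub_add_eq_max, tsub_add_eq_max, max_comm]

theorem measurable_topSub {α : Type*} [MeasurableSpace α] {a b : α → ENNReal}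
    (ha : Measurable a) (hb : Measurable b) : Measurable (fun x => topSub (a x) (b x)) := by
  refine Measurable.ite (ha (measurableSet_singleton ⊤)) measurable_const ?_
  exact ha.coe_ereal_ennreal.sub hb.coe_ereal_ennreal

variable {α β : Type*} [MeasurableSpace α] [MeasurableSpace β]

theorem expect_mono_ae {μ : Measure α} {Y Y' : α → EReal} (h : Y ≤ᵐ[μ] Y') :
    expect μ Y ≤ expect μ Y' := by
  refine topSub_mono (lintegral_mono_ae ?_) (lintegral_mono_ae ?_)
  · filter_upwards [h] with x hx using EReal.toENNReal_le_toENNReal hx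
  · filter_upwards [h] with x hx using EReal.toENNReal_le_toENNReal (EReal.neg_le_neg_iff.2 hx)

theorem expect_congr_ae {μ : Measure α} {Y Y' : α → EReal} (h : Y =ᵐ[μ] Y') :
    expect μ Y = expect μ Y' :=
  le_antisymm (expect_mono_ae h.le) (expect_mono_ae h.symm.le)

theorem expect_map {μ : Measure α} {g : α → β} (hg : Measurable g) {Y : β → EReal}
    (hY : Measurable Y) : expect (μ.map g) Y = expect μ (fun a => Y (g a)) := by
  have hn : Measurable fun b => (-Y b).toENNReal := hY.neg.ereal_toENNReal
  rw [expect_eq_topSub, expect_eq_topSub, lintegral_map hY.ereal_toENNReal hg,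
    lintegral_map hn hg]

theorem EReal.eq_of_toENNReal_eq {x y : EReal} (h1 : x.toENNReal = y.toENNReal)
    (h2 : (-x).toENNReal = (-y).toENNReal) : x = y := by
  rcases le_total 0 x with hx | hx
  · rcases le_total 0 y with hy | hy
    · exact (EReal.toENNReal_eq_toENNReal hx hy).1 h1
    · rw [EReal.toENNReal_of_nonpos hy, EReal.toENNReal_eq_zero_iff] at h1
      rw [EReal.toENNReal_of_nonpos (x := -x) (by simpa using hx), eq_comm,
        EReal.toENNReal_eq_zero_iff, EReal.neg_le, neg_zero] at h2
      rw [le_antisymm h1 hx, le_antisymm hy h2]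
  · rcases le_total 0 y with hy | hy
    · rw [EReal.toENNReal_of_nonpos hx, eq_comm, EReal.toENNReal_eq_zero_iff] at h1
      rw [EReal.toENNReal_of_nonpos (x := -y) (by simpa using hy),
        EReal.toENNReal_eq_zero_iff, EReal.neg_le, neg_zero] at h2
      rw [le_antisymm hx h2, le_antisymm h1 hy]
    · exact neg_injective ((EReal.toENNReal_eq_toENNReal (by simpa using hx)
        (by simpa using hy)).1 h2)

/-- Ordered integrands with the same finite expectation agree almost everywhere. -/
theorem ae_eq_of_expect_eq {μ : Measure α} {Y Y' : α → EReal} (hY : AEMeasurable Y μ)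
    (hY' : AEMeasurable Y' μ) (hle : Y ≤ᵐ[μ] Y') (heq : expect μ Y = expect μ Y')
    (htop : expect μ Y' ≠ ⊤) (hbot : expect μ Y' ≠ ⊥) : Y =ᵐ[μ] Y' := by
  obtain ⟨hp', hn'⟩ := ne_top_of_topSub_ne htop hbot
  obtain ⟨hp, hn⟩ := ne_top_of_topSub_ne (heq.trans_ne htop) (heq.trans_ne hbot)
  have hlep : (fun a => (Y a).toENNReal) ≤ᵐ[μ] fun a => (Y' a).toENNReal := by
    filter_upwards [hle] with x hx using EReal.toENNReal_le_toENNReal hx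
  have hlen : (fun a => (-Y' a).toENNReal) ≤ᵐ[μ] fun a => (-Y a).toENNReal := by
    filter_upwards [hle] with x hx using EReal.toENNReal_le_toENNReal (EReal.neg_le_neg_iff.2 hx)
  have hip := (ENNReal.toReal_le_toReal hp hp').2 (lintegral_mono_ae hlep)
  have hin := (ENNReal.toReal_le_toReal hn' hn).2 (lintegral_mono_ae hlen)
  rw [expect_eq_topSub, expect_eq_topSub, topSub_of_ne_top hp hn, topSub_of_ne_top hp' hn',
    EReal.coe_eq_coe_iff] at heq
  -- Positive parts increase and negative parts decrease from `Y` to `Y'`; with finite integrals,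
  -- equal differences leave no room for either to change.
  have hep := ae_eq_of_ae_le_of_lintegral_le hlep hp hY'.ereal_toENNReal
    ((ENNReal.toReal_le_toReal hp' hp).1 (by linarith))
  have hen := ae_eq_of_ae_le_of_lintegral_le hlen hn' hY.neg.ereal_toENNReal
    ((ENNReal.toReal_le_toReal hn hn').1 (by linarith))
  filter_upwards [hep, hen] with x h1 h2 using EReal.eq_of_toENNReal_eq h1 h2.symm

theorem measurable_expect_kernel {κ : Kernel α β} [IsSFiniteKernel κ] {Y : α × β → EReal}
    (hY : Measurable Y) : Measurable (fun x => expect (κ x) (fun y => Y (x, y))) :=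
  measurable_topSub hY.ereal_toENNReal.lintegral_kernel_prod_right'
    hY.neg.ereal_toENNReal.lintegral_kernel_prod_right'

/-- Disintegration of the extended expectation. -/
theorem expect_compProd {μ : Measure α} [SFinite μ] {κ : Kernel α β} [IsSFiniteKernel κ]
    {Y : α × β → EReal} (hY : Measurable Y)
    (hfin : ∫⁻ p, (Y p).toENNReal ∂(μ ⊗ₘ κ) ≠ ⊤ ∨ ∫⁻ p, (-(Y p)).toENNReal ∂(μ ⊗ₘ κ) ≠ ⊤) :
    expect μ (fun x => expect (κ x) (fun y => Y (x, y))) = expect (μ ⊗ₘ κ) Y := by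
  have hpm := hY.ereal_toENNReal
  have hnm : Measurable fun p => (-Y p).toENNReal := hY.neg.ereal_toENNReal
  have ham : Measurable fun x => ∫⁻ y, (Y (x, y)).toENNReal ∂κ x :=
    hpm.lintegral_kernel_prod_right'
  have hbm : Measurable fun x => ∫⁻ y, (-Y (x, y)).toENNReal ∂κ x :=
    hnm.lintegral_kernel_prod_right'
  rw [expect_eq_topSub (μ ⊗ₘ κ), expect_eq_topSub μ]
  rw [Measure.lintegral_compProd hpm, Measure.lintegral_compProd hnm] at hfin ⊢
  set a := fun x => ∫⁻ y, (Y (x, y)).toENNReal ∂κ x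
  set b := fun x => ∫⁻ y, (-Y (x, y)).toENNReal ∂κ x
  change topSub (∫⁻ x, (topSub (a x) (b x)).toENNReal ∂μ)
    (∫⁻ x, (-topSub (a x) (b x)).toENNReal ∂μ) = topSub (∫⁻ x, a x ∂μ) (∫⁻ x, b x ∂μ)
  change ∫⁻ x, a x ∂μ ≠ ⊤ ∨ ∫⁻ x, b x ∂μ ≠ ⊤ at hfin
  have hC1 : ∫⁻ x, (topSub (a x) (b x)).toENNReal ∂μ ≤ ∫⁻ x, a x ∂μ :=
    lintegral_mono fun x => toENNReal_topSub_le _ _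
  have hC2 : ∫⁻ x, (-topSub (a x) (b x)).toENNReal ∂μ ≤ ∫⁻ x, b x ∂μ :=
    lintegral_mono fun x => toENNReal_neg_topSub_le _ _
  rcases eq_or_ne (∫⁻ x, a x ∂μ) ⊤ with hA | hA
  · have hB := hfin.resolve_left (not_not.2 hA)
    -- Since `∫ b` is finite, infinite `∫ a` forces the positive part of the conditional expectation
    -- to have infinite integral.
    have h : ∫⁻ x, a x ∂μ ≤ ∫⁻ x, (topSub (a x) (b x)).toENNReal ∂μ + ∫⁻ x, b x ∂μ := by
      rw [← lintegral_add_right _ hbm]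
      exact lintegral_mono fun x => le_toENNReal_topSub_add _ _
    rw [hA, top_le_iff, ENNReal.add_eq_top] at h
    rw [h.resolve_right hB, hA, topSub_top, topSub_top]
  · have hC1' := ne_top_of_le_ne_top hA hC1
    have h : ∫⁻ x, (topSub (a x) (b x)).toENNReal ∂μ + ∫⁻ x, b x ∂μ =
        ∫⁻ x, (-topSub (a x) (b x)).toENNReal ∂μ + ∫⁻ x, a x ∂μ := by
      rw [← lintegral_add_right _ hbm, ← lintegral_add_right _ ham]
      refine lintegral_congr_ae ?_
      filter_upwards [ae_lt_top ham hA] with x hx using toENNReal_topSub_add hx.ne _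
    rcases eq_or_ne (∫⁻ x, b x ∂μ) ⊤ with hB | hB
    · rw [hB, add_top, eq_comm, ENNReal.add_eq_top] at h
      rw [h.resolve_right hA, hB, topSub_of_ne_top_of_top hA, topSub_of_ne_top_of_top hC1']
    · exact topSub_inj_of_add_eq hC1' (ne_top_of_le_ne_top hB hC2) hA hB h

theorem integrable_of_lintegral_ofReal_ne_top {μ : Measure α} {Y : α → ℝ} (hY : Measurable Y)
    (hp : ∫⁻ a, ENNReal.ofReal (Y a) ∂μ ≠ ⊤) (hn : ∫⁻ a, ENNReal.ofReal (-Y a) ∂μ ≠ ⊤) :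
    Integrable Y μ := by
  refine ⟨hY.aestronglyMeasurable, ?_⟩
  rw [hasFiniteIntegral_iff_norm]
  have h : ∀ a, ENNReal.ofReal ‖Y a‖ ≤ ENNReal.ofReal (Y a) + ENNReal.ofReal (-Y a) := by
    intro a
    rcases le_total 0 (Y a) with h | h
    · rw [Real.norm_of_nonneg h]
      exact le_self_add
    · rw [Real.norm_of_nonpos h]
      exact le_add_self
  calc ∫⁻ a, ENNReal.ofReal ‖Y a‖ ∂μ
      ≤ ∫⁻ a, (ENNReal.ofReal (Y a) + ENNReal.ofReal (-Y a)) ∂μ := lintegral_mono h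
    _ = ∫⁻ a, ENNReal.ofReal (Y a) ∂μ + ∫⁻ a, ENNReal.ofReal (-Y a) ∂μ :=
        lintegral_add_left hY.ennreal_ofReal _
    _ < ⊤ := ENNReal.add_lt_top.2 ⟨hp.lt_top, hn.lt_top⟩

theorem expect_coe_of_integrable {μ : Measure α} {Y : α → ℝ} (hY : Integrable Y μ) :
    expect μ (fun a => (Y a : EReal)) = ((∫ a, Y a ∂μ : ℝ) : EReal) := by
  rw [integral_eq_lintegral_pos_part_sub_lintegral_neg_part hY]
  refine topSub_of_ne_top ?_ ?_
  · exact (hY.lintegral_lt_top).ne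
  · exact (hY.neg.lintegral_lt_top).ne

end Expectation

/-! ### Comparison of policies and extension from a skeleton -/

section Policies

open Set

variable {s n m r : ℕ}

/-- As `f` is measurable only on `Z`, joint measurability of the cost needs policies valued in `Z`
everywhere; the complement of the support is null. -/
theorem exists_policy_ae_eq {FX : Measure (Fin s → ℝ)} {Z : Set (Fin n → ℝ)} (hZ : Z.Nonempty)
    {π : (Fin s → ℝ) → (Fin n → ℝ)} (hπ : π ∈ policies FX Z) :
    ∃ π' : (Fin s → ℝ) → (Fin n → ℝ), Measurable π' ∧ (∀ x, π' x ∈ Z) ∧ π' =ᵐ[FX] π := by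
  classical
  obtain ⟨z, hz⟩ := hZ
  refine ⟨FX.support.piecewise π (fun _ => z), ?_, fun x => ?_, ?_⟩
  · exact hπ.1.piecewise Measure.isClosed_support.measurableSet measurable_const
  · by_cases hx : x ∈ FX.support
    · simpa [hx] using hπ.2 x hx
    · simpa [hx] using hz
  · filter_upwards [Measure.support_mem_ae] with x hx
    simp [hx]

theorem performance_congr_ae {FX : Measure (Fin s → ℝ)} {κ : Kernel (Fin s → ℝ) (Scenario m n)}
    {G : (Fin n → ℝ) → Scenario m n → EReal} {π π' : (Fin s → ℝ) → (Fin n → ℝ)}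
    (h : π =ᵐ[FX] π') : performance FX κ G π = performance FX κ G π' := by
  refine expect_congr_ae ?_
  filter_upwards [h] with x hx
  rw [hx]

theorem ContextualTwoStage.IsCondOptimalPolicy.isOptimalPolicy {FX : Measure (Fin s → ℝ)}
    {κ : Kernel (Fin s → ℝ) (Scenario m n)} {G : (Fin n → ℝ) → Scenario m n → EReal}
    {Z : Set (Fin n → ℝ)} {π : (Fin s → ℝ) → (Fin n → ℝ)}
    (h : IsCondOptimalPolicy FX κ G Z π) : IsOptimalPolicy FX κ G Z π := by
  refine ⟨h.1, fun π' hπ' => expect_mono_ae ?_⟩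
  filter_upwards [Measure.support_mem_ae] with x hx using (h.2 x hx).2 _ (hπ'.2 x hx)

/-- An optimal policy with finite performance is almost everywhere at least as good,
conditionally on the features, as any other policy. -/
theorem ContextualTwoStage.IsOptimalPolicy.condCost_le_ae {FX : Measure (Fin s → ℝ)}
    {κ : Kernel (Fin s → ℝ) (Scenario m n)} [IsMarkovKernel κ]
    {G : (Fin n → ℝ) → Scenario m n → EReal} {Z : Set (Fin n → ℝ)} (hZ : Z.Nonempty)
    (hG : ∀ π : (Fin s → ℝ) → (Fin n → ℝ), Measurable π → (∀ x, π x ∈ Z) →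
      Measurable (fun p : (Fin s → ℝ) × Scenario m n => G (π p.1) p.2))
    {πopt π : (Fin s → ℝ) → (Fin n → ℝ)} (hopt : IsOptimalPolicy FX κ G Z πopt)
    (htop : performance FX κ G πopt ≠ ⊤) (hbot : performance FX κ G πopt ≠ ⊥)
    (hπ : π ∈ policies FX Z) :
    ∀ᵐ x ∂FX, condCost κ G (πopt x) x ≤ condCost κ G (π x) x := by
  classical
  obtain ⟨π₁, hm₁, hZ₁, he₁⟩ := exists_policy_ae_eq hZ hopt.1
  obtain ⟨π₂, hm₂, hZ₂, he₂⟩ := exists_policy_ae_eq hZ hπ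
  have hc : ∀ π : (Fin s → ℝ) → (Fin n → ℝ), Measurable π → (∀ x, π x ∈ Z) →
      Measurable (fun x => condCost κ G (π x) x) := fun π hm hπZ =>
    measurable_expect_kernel (hG π hm hπZ)
  -- The patched policy `π₃` uses the competitor exactly on `A`. Optimality makes its performance
  -- equal to that of `π₁`, and finiteness turns this into almost everywhere equality of conditional
  -- costs, so `A` is null.
  let A : Set (Fin s → ℝ) := {x | condCost κ G (π₂ x) x < condCost κ G (π₁ x) x}
  have hA : MeasurableSet A := measurableSet_lt (hc _ hm₂ hZ₂) (hc _ hm₁ hZ₁)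
  let π₃ := A.piecewise π₂ π₁
  have hm₃ : Measurable π₃ := hm₂.piecewise hA hm₁
  have hZ₃ : ∀ x, π₃ x ∈ Z := fun x => by
    by_cases hx : x ∈ A
    · simpa [π₃, hx] using hZ₂ x
    · simpa [π₃, hx] using hZ₁ x
  have hle : ∀ x, condCost κ G (π₃ x) x ≤ condCost κ G (π₁ x) x := fun x => by
    by_cases hx : x ∈ A
    · simpa [π₃, hx] using le_of_lt hx
    · simp [π₃, hx]
  have hp₁ : performance FX κ G π₁ = performance FX κ G πopt := performance_congr_ae he₁
  have heq : performance FX κ G π₃ = performance FX κ G π₁ :=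
    le_antisymm (expect_mono_ae (Filter.Eventually.of_forall hle))
      (hp₁ ▸ hopt.2 π₃ ⟨hm₃, fun x _ => hZ₃ x⟩)
  have hae := ae_eq_of_expect_eq (hc _ hm₃ hZ₃).aemeasurable (hc _ hm₁ hZ₁).aemeasurable
    (Filter.Eventually.of_forall hle) heq (hp₁.trans_ne htop) (hp₁.trans_ne hbot)
  filter_upwards [hae, he₁, he₂] with x hx h₁ h₂
  rw [← h₁, ← h₂]
  by_cases hxA : x ∈ A
  · have : condCost κ G (π₂ x) x = condCost κ G (π₁ x) x := by simpa [π₃, hxA] using hx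
    exact this.ge
  · exact not_lt.1 hxA

/-- For a random convex function, a bound on the expectations on a skeleton of `Z` is a bound on
all of `Z`. -/
theorem le_expect_of_isConvexSkeleton {E B : Type*} [AddCommGroup E] [Module ℝ E]
    [MeasurableSpace B] {μ : Measure B} {Z S : Set E} (hZ : Convex ℝ Z)
    (hS : IsConvexSkeleton S Z) {g : E → B → ℝ} (hgm : ∀ z ∈ Z, Measurable (g z))
    (hg : ∀ b, ConvexOn ℝ Z (fun z => g z b)) (hint : ∀ z ∈ S, Integrable (g z) μ) {c : EReal}
    (hc : ∀ z ∈ S, c ≤ expect μ (fun b => (g z b : EReal))) :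
    ∀ z ∈ Z, c ≤ expect μ (fun b => (g z b : EReal)) := by
  obtain ⟨hSZ, -, hS⟩ := hS
  -- Off `C` the expectation is `+∞` by convention, so the bound is trivial there.
  let C : Set E := {z | z ∈ Z ∧ ∫⁻ b, ENNReal.ofReal (g z b) ∂μ ≠ ⊤}
  have hC : Convex ℝ C := by
    intro z₁ h₁ z₂ h₂ a b ha hb hab
    refine ⟨hZ h₁.1 h₂.1 ha hb hab, ne_top_of_le_ne_top (b := ENNReal.ofReal a *
      ∫⁻ x, ENNReal.ofReal (g z₁ x) ∂μ + ENNReal.ofReal b * ∫⁻ x, ENNReal.ofReal (g z₂ x) ∂μ)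
      (ENNReal.add_ne_top.2 ⟨ENNReal.mul_ne_top ENNReal.ofReal_ne_top h₁.2,
        ENNReal.mul_ne_top ENNReal.ofReal_ne_top h₂.2⟩) ?_⟩
    have hm₁ := (hgm z₁ h₁.1).ennreal_ofReal
    have hm₂ := (hgm z₂ h₂.1).ennreal_ofReal
    rw [← lintegral_const_mul _ hm₁, ← lintegral_const_mul _ hm₂,
      ← lintegral_add_left (hm₁.const_mul _)]
    refine lintegral_mono fun x => ?_
    rw [← ENNReal.ofReal_mul ha, ← ENNReal.ofReal_mul hb]
    exact (ENNReal.ofReal_le_ofReal ((hg x).2 h₁.1 h₂.1 ha hb hab)).trans ENNReal.ofReal_add_le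
  have hSC : S ⊆ C := fun z hz => ⟨hSZ hz, (hint z hz).lintegral_lt_top.ne⟩
  obtain ⟨hlow, hsep⟩ := hS C hC hSC fun z hz => hz.1
  have hCint : ∀ z ∈ C, Integrable (g z) μ := by
    intro z hz
    refine integrable_of_lintegral_ofReal_ne_top (hgm z hz.1) hz.2 ?_
    obtain ⟨w, hw, t, ht, hwt⟩ := hsep z hz.1
    have ht0 : 0 < t := ht.1
    have ht1 : 0 ≤ 1 - t := by linarith [ht.2]
    let p := (1 - t) • w + t • z
    -- Convexity at `p`, between `w` and `z`, is solved for `-g z x`. Integrability at `p` and the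
    -- finite positive part at `w` then control the negative part at `z`.
    have hb : ∀ x, -g z x ≤ (1 - t) / t * g w x + t⁻¹ * -g p x := by
      intro x
      have h := (hg x).2 hw.1 hz.1 ht1 ht0.le (by ring)
      simp only [smul_eq_mul] at h
      change g p x ≤ _ at h
      rw [div_mul_eq_mul_div, inv_mul_eq_div, ← add_div, le_div_iff₀ ht0]
      linarith
    have hmw := (hgm w hw.1).ennreal_ofReal
    have hmp : Measurable fun x => ENNReal.ofReal (-g p x) := (hgm p (hSZ hwt)).neg.ennreal_ofReal
    have hfin : ENNReal.ofReal ((1 - t) / t) * ∫⁻ x, ENNReal.ofReal (g w x) ∂μ +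
        ENNReal.ofReal t⁻¹ * ∫⁻ x, ENNReal.ofReal (-g p x) ∂μ ≠ ⊤ :=
      ENNReal.add_ne_top.2 ⟨ENNReal.mul_ne_top ENNReal.ofReal_ne_top hw.2,
        ENNReal.mul_ne_top ENNReal.ofReal_ne_top (hint p hwt).neg.lintegral_lt_top.ne⟩
    refine ne_top_of_le_ne_top hfin ?_
    rw [← lintegral_const_mul _ hmw, ← lintegral_const_mul _ hmp,
      ← lintegral_add_left (hmw.const_mul _)]
    refine lintegral_mono fun x => ?_
    rw [← ENNReal.ofReal_mul (by positivity), ← ENNReal.ofReal_mul (by positivity)]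
    exact (ENNReal.ofReal_le_ofReal (hb x)).trans ENNReal.ofReal_add_le
  have hconv : ConvexOn ℝ C (fun z => ∫ b, g z b ∂μ) := by
    refine ⟨hC, fun z₁ h₁ z₂ h₂ a b ha hb hab => ?_⟩
    have i₁ := hCint z₁ h₁
    have i₂ := hCint z₂ h₂
    simp only [smul_eq_mul]
    rw [← integral_const_mul, ← integral_const_mul,
      ← integral_add (i₁.const_mul a) (i₂.const_mul b)]
    exact integral_mono (hCint _ (hC h₁ h₂ ha hb hab)) ((i₁.const_mul a).add (i₂.const_mul b))
      fun x => (hg x).2 h₁.1 h₂.1 ha hb hab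
  intro z hz
  by_cases hzC : z ∈ C
  · rw [expect_coe_of_integrable (hCint z hzC)]
    -- The extended bound `c` is tested through real `M < c`, since the skeleton property concerns
    -- real bounds.
    refine EReal.ge_of_forall_gt_iff_ge.1 fun M hM => EReal.coe_le_coe_iff.2 ?_
    refine hlow _ M hconv (fun w hw => ?_) z hzC
    have h := hM.le.trans (hc w hw)
    rwa [expect_coe_of_integrable (hint w hw), EReal.coe_le_coe_iff] at h
  · have : ∫⁻ b, (g z b : EReal).toENNReal ∂μ = ⊤ := by
      by_contra h
      exact hzC ⟨hz, h⟩
    rw [expect_eq_topSub, this, topSub_top]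
    exact le_top

theorem ae_integrable_of_expect_finite {A B : Type*} [MeasurableSpace A] [MeasurableSpace B]
    {μ : Measure A} [SFinite μ] {κ : Kernel A B} [IsSFiniteKernel κ] {Y : B → ℝ}
    (hY : Measurable Y) (htop : expect (μ ⊗ₘ κ) (fun p => (Y p.2 : EReal)) ≠ ⊤)
    (hbot : expect (μ ⊗ₘ κ) (fun p => (Y p.2 : EReal)) ≠ ⊥) :
    ∀ᵐ x ∂μ, Integrable Y (κ x) := by
  obtain ⟨hp, hn⟩ := ne_top_of_topSub_ne htop hbot
  have hpm : Measurable fun p : A × B => ENNReal.ofReal (Y p.2) :=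
    (hY.comp measurable_snd).ennreal_ofReal
  have hnm : Measurable fun p : A × B => ENNReal.ofReal (-Y p.2) :=
    (hY.comp measurable_snd).neg.ennreal_ofReal
  change ∫⁻ p : A × B, ENNReal.ofReal (Y p.2) ∂(μ ⊗ₘ κ) ≠ ⊤ at hp
  change ∫⁻ p : A × B, ENNReal.ofReal (-Y p.2) ∂(μ ⊗ₘ κ) ≠ ⊤ at hn
  rw [Measure.lintegral_compProd hpm] at hp
  rw [Measure.lintegral_compProd hnm] at hn
  filter_upwards [ae_lt_top hpm.lintegral_kernel_prod_right' hp,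
    ae_lt_top hnm.lintegral_kernel_prod_right' hn] with x h₁ h₂
  exact integrable_of_lintegral_ofReal_ne_top hY h₁.ne h₂.ne

end Policies

/-! ### The three claims for the two-stage problem -/

theorem proposition1 {Ω : Type*} [MeasurableSpace Ω] (P : Measure Ω) [IsProbabilityMeasure P]
    {s n m r : ℕ}
    -- features `X`, scenario `ξ = (h, T)`, and a conditional distribution `κ` of `ξ` given `X`
    (X : Ω → (Fin s → ℝ)) (hX : Measurable X)
    (ξ : Ω → Scenario m n) (hξ : Measurable ξ)
    (κ : Kernel (Fin s → ℝ) (Scenario m n)) (hκ : IsCondLaw P X ξ κ)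
    -- first stage: convex feasible set `Z`, convex cost `f` with domain `D ⊇ Z`
    (Z D : Set (Fin n → ℝ)) (hZ : Convex ℝ Z) (f : (Fin n → ℝ) → ℝ) (hf : ConvexOn ℝ D f)
    (hZD : Z ⊆ D) (hfm : Measurable (fun z : Z => f z))
    -- second stage: fixed recourse matrix `W` and fixed costs `q`
    (W : Matrix (Fin m) (Fin r) ℝ) (q : Fin r → ℝ)
    -- `Z` and the relative interior of the domain of `f` are non-empty
    (hZne : Z.Nonempty) (hri : (intrinsicInterior ℝ D).Nonempty)
    -- the dual feasible set of the second stage is non-empty and bounded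
    (hUne : (dualSet W q).Nonempty) (hUb : Bornology.IsBounded (dualSet W q))
    -- the total cost `G(z, ξ) = f(z) + Q(z, ξ)` of the two-stage problem
    (G : (Fin n → ℝ) → Scenario m n → EReal) (hG : G = totalCost f W q) :
    -- a pointwise optimal policy minimizes the average performance
    (∀ πS : (Fin s → ℝ) → (Fin n → ℝ),
      IsCondOptimalPolicy (P.map X) κ G Z πS → IsOptimalPolicy (P.map X) κ G Z πS) ∧
    -- a minimizer of the average performance with finite value is pointwise optimal, for
    -- almost every `x`
    (∀ πopt : (Fin s → ℝ) → (Fin n → ℝ),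
      IsOptimalPolicy (P.map X) κ G Z πopt →
      performance (P.map X) κ G πopt ≠ ⊤ → performance (P.map X) κ G πopt ≠ ⊥ →
      ((∃ πS : (Fin s → ℝ) → (Fin n → ℝ), IsCondOptimalPolicy (P.map X) κ G Z πS) ∨
        (∀ z ∈ Z, expect P (fun ω => G z (ξ ω)) ≠ ⊤ ∧ expect P (fun ω => G z (ξ ω)) ≠ ⊥)) →
      ∀ᵐ x ∂(P.map X), πopt x ∈ condArgmin κ G Z x) ∧
    -- the average performance is `E[G(π(X), ξ)]` whenever this expectation is well defined
    (∀ π ∈ policies (P.map X) Z,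
      (∫⁻ ω, (G (π (X ω)) (ξ ω)).toENNReal ∂P ≠ ⊤ ∨
        ∫⁻ ω, (-(G (π (X ω)) (ξ ω))).toENNReal ∂P ≠ ⊤) →
      performance (P.map X) κ G π = expect P (fun ω => G (π (X ω)) (ξ ω))) := by
  obtain ⟨hκM, hκ⟩ := hκ
  have hFX : IsProbabilityMeasure (P.map X) := Measure.isProbabilityMeasure_map hX.aemeasurable
  have hfZ : ConvexOn ℝ Z f := hf.subset hZD hZ
  obtain rfl : G = fun z ξ => (realCost f W q z ξ : EReal) := by
    subst hG
    funext z ξ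
    exact totalCost_eq_coe hUne hUb f z ξ
  have hjoint : ∀ π : (Fin s → ℝ) → (Fin n → ℝ), Measurable π → (∀ x, π x ∈ Z) →
      Measurable (fun p : (Fin s → ℝ) × Scenario m n => (realCost f W q (π p.1) p.2 : EReal)) :=
    fun π hπ hπZ => (measurable_realCost_comp hUne hUb hfm hπ hπZ).coe_real_ereal
  have hXξ : Measurable fun ω => (X ω, ξ ω) := hX.prodMk hξ
  refine ⟨fun πS hS => hS.isOptimalPolicy, ?_, ?_⟩
  · rintro πopt hopt htop hbot (⟨πS, hS⟩ | hfin)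
    · filter_upwards [hopt.condCost_le_ae hZne hjoint htop hbot hS.1, Measure.support_mem_ae]
        with x hx hxs
      exact ⟨hopt.1.2 x hxs, fun z hz => hx.trans ((hS.2 x hxs).2 z hz)⟩
    · obtain ⟨S, hS⟩ := hZ.exists_isConvexSkeleton hZne
      have hgm : ∀ z ∈ Z, Measurable (realCost f W q z : Scenario m n → ℝ) := fun z hz =>
        measurable_realCost hUne hUb f z
      have hint : ∀ z ∈ S, ∀ᵐ x ∂(P.map X), Integrable (realCost f W q z) (κ x) := by
        intro z hz
        have h := hfin z (hS.1 hz)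
        rw [← expect_map hXξ (Y := fun p : (Fin s → ℝ) × Scenario m n =>
          (realCost f W q z p.2 : EReal)) (hjoint (fun _ => z) measurable_const
            fun _ => hS.1 hz), ← hκ] at h
        exact ae_integrable_of_expect_finite (hgm z (hS.1 hz)) h.1 h.2
      have hle : ∀ z ∈ S, ∀ᵐ x ∂(P.map X),
          condCost κ (fun z ξ => (realCost f W q z ξ : EReal)) (πopt x) x ≤
            condCost κ (fun z ξ => (realCost f W q z ξ : EReal)) z x := fun z hz =>
        hopt.condCost_le_ae (π := fun _ => z) hZne hjoint htop hbot
          ⟨measurable_const, fun _ _ => hS.1 hz⟩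
      -- Countability of `S` merges the exceptional null sets of its points into one.
      filter_upwards [(ae_ball_iff hS.2.1).2 hint, (ae_ball_iff hS.2.1).2 hle,
        Measure.support_mem_ae] with x h₁ h₂ hxs
      exact ⟨hopt.1.2 x hxs, le_expect_of_isConvexSkeleton hZ hS hgm
        (convexOn_realCost hUne hUb hfZ) h₁ h₂⟩
  · intro π hπ hfin
    obtain ⟨π', hm, hZ', he⟩ := exists_policy_ae_eq hZne hπ
    have heX : (fun ω => (realCost f W q (π' (X ω)) (ξ ω) : EReal)) =ᵐ[P]
        fun ω => (realCost f W q (π (X ω)) (ξ ω) : EReal) := by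
      filter_upwards [ae_of_ae_map hX.aemeasurable he] with ω hω
      rw [hω]
    have hY := hjoint π' hm hZ'
    have hYn : Measurable fun p : (Fin s → ℝ) × Scenario m n =>
      (-(realCost f W q (π' p.1) p.2 : EReal)).toENNReal := hY.neg.ereal_toENNReal
    rw [← performance_congr_ae he, ← expect_congr_ae heX, ← expect_map hXξ hY, ← hκ]
    refine expect_compProd hY ?_
    rw [hκ, lintegral_map hY.ereal_toENNReal hXξ, lintegral_map hYn hXξ]
    refine hfin.imp (fun h => ?_) (fun h => ?_)
    · rwa [lintegral_congr_ae (g := fun ω => (realCost f W q (π (X ω)) (ξ ω) : EReal).toENNReal)]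
      filter_upwards [heX] with ω hω
      rw [hω]
    · rwa [lintegral_congr_ae
        (g := fun ω => (-(realCost f W q (π (X ω)) (ξ ω) : EReal)).toENNReal)]
      filter_upwards [heX] with ω hω
      rw [hω]
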